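/- Let $K > 0$ and $\varepsilon > 0$ be real numbers and let $k_0 \ge 1$ be an integer. Then there is a constant $c > 0$, depending only on $K$, $k_0$ and $\varepsilon$, such that the following holds. Let $G$ be a (multiplicative, not necessarily abelian) group and let $A$ be a finite non-empty subset of $G$ with $|A \cdot A^{-1}| \le K|A|$, where $A \cdot A^{-1} := \{ab^{-1} : a, b \in A\}$. Then there is a set $D \subset A \cdot A^{-1}$ which is centred, that is, $1 \in D$ and $D^{-1} = D$, such that $|D| \ge c|A|$ and such that, for every integer $1 \le k \le k_0$, there are at least $(1-\varepsilon)|D|^k$ tuples $(d_1,\ldots,d_k) \in D^k$ (the $k$-fold Cartesian product) with $d_1 d_2 \cdots d_k \in A \cdot A^{-1}$. -/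

import Mathlib

open scoped Pointwise

/-- A finite subset of a group is centred if it contains the identity and is symmetric. -/
def IsCentred {G : Type*} [Group G] [DecidableEq G] (D : Finset G) : Prop :=
  (1 : G) ∈ D ∧ D⁻¹ = D

/-- The set of `k`-tuples `(d₁, …, d_k)` of elements of `D` whose ordered product
`d₁ ⋯ d_k` lies in `B`. -/
def tuplesWithProdIn {G : Type*} [Group G] [DecidableEq G] (k : ℕ) (D B : Finset G) :
    Finset (Fin k → G) :=
  (Fintype.piFinset fun _ : Fin k => D).filter fun d => (List.ofFn d).prod ∈ B

/-! In ℓ²(G) let v be the indicator of A, S the average of right translations over A, T its adjoint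
and P = 1 - TS. The form Q_n(φ) = ‖φ‖² - ‖Pⁿφ‖² is nonnegative, increasing in n and invariant under
left translation. Hence the displacement Q_n(xv - v) is the square of a left-invariant pseudometric,
and a product of k elements of displacement at most η has displacement at most 4^k η.

If z ∉ A A⁻¹, then zv ⟂ v, so small displacement forces ⟨zv, P²ⁿv⟩ ≤ -|A|/(2K). Since ‖S P²ⁿv‖² ≤
|A|/(2n), only O(K²|A|/n) such z exist (`card_mul_le_of_displacement_le`). So D can be the set of
elements of A A⁻¹ of small displacement at level N, if |D| is much larger than K²|A|/N.

Croot–Sisask sampling (`exists_almostPeriods`) gives at least |A|/(2K^m) elements x with ‖S(xv -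
v)‖² ≤ 32|A|/m, hence of small displacement at levels n much below m, whereas N must exceed K^m. The
passage from n to N costs a multiple of Q_N(v) - Q_n(v), which is small for some pair in a tower of
scales because Q_n(v) ≤ |A| (`exists_isCentred_of_two_sided`). Sampling needs |A⁻¹A| small, so one
first passes to a large subset (`exists_subset_card_inv_mul_le`). -/

/-! ### Iterates of 1 - TS and the norm defect as a quadratic form. -/

section Contraction

variable {V : Type*} [NormedAddCommGroup V] [InnerProductSpace ℝ V]

/-- If `T` is an adjoint of a contraction `S`, this is the operator `1 - T S`. -/
def complOp (S T : V →ₗ[ℝ] V) : V →ₗ[ℝ] V := LinearMap.id - T ∘ₗ S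

/-- A pair of mutually adjoint contractions. -/
structure AdjointContractions (S T : V →ₗ[ℝ] V) : Prop where
  inner_eq : ∀ x y, inner ℝ (S x) y = inner ℝ x (T y)
  left_le : ∀ x, ‖S x‖ ≤ ‖x‖
  right_le : ∀ x, ‖T x‖ ≤ ‖x‖

namespace AdjointContractions

variable {S T : V →ₗ[ℝ] V}

theorem symm (h : AdjointContractions S T) : AdjointContractions T S where
  inner_eq x y := by rw [real_inner_comm, ← h.inner_eq, real_inner_comm]
  left_le := h.right_le
  right_le := h.left_le

theorem norm_sq_complOp (h : AdjointContractions S T) (x : V) :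
    ‖complOp S T x‖ ^ 2 = ‖x‖ ^ 2 - 2 * ‖S x‖ ^ 2 + ‖T (S x)‖ ^ 2 := by
  have : complOp S T x = x - T (S x) := rfl
  rw [this, norm_sub_sq_real, ← h.inner_eq, real_inner_self_eq_norm_sq]

theorem norm_sq_complOp_add_le (h : AdjointContractions S T) (x : V) :
    ‖complOp S T x‖ ^ 2 + ‖S x‖ ^ 2 ≤ ‖x‖ ^ 2 := by
  have h1 := h.norm_sq_complOp x
  have h2 := pow_le_pow_left₀ (norm_nonneg _) (h.right_le (S x)) 2
  linarith

theorem norm_sq_le_complOp (h : AdjointContractions S T) (x : V) :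
    ‖x‖ ^ 2 ≤ ‖complOp S T x‖ ^ 2 + 2 * ‖S x‖ ^ 2 := by
  have h1 := h.norm_sq_complOp x
  have h2 := sq_nonneg ‖T (S x)‖
  linarith

/-- S(1 - TS) = (1 - ST)S, and 1 - ST is again a contraction. -/
theorem norm_sq_apply_complOp_le (h : AdjointContractions S T) (x : V) :
    ‖S (complOp S T x)‖ ^ 2 ≤ ‖S x‖ ^ 2 := by
  have h1 : S (complOp S T x) = complOp T S (S x) := by simp [complOp]
  have h2 := h.symm.norm_sq_complOp_add_le (S x)
  rw [h1]
  nlinarith [sq_nonneg ‖T (S x)‖]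

theorem inner_complOp (h : AdjointContractions S T) (x y : V) :
    inner ℝ (complOp S T x) y = inner ℝ x (complOp S T y) := by
  simp only [complOp, LinearMap.sub_apply, LinearMap.id_apply, LinearMap.comp_apply,
    inner_sub_left, inner_sub_right]
  rw [h.symm.inner_eq, ← h.inner_eq]

theorem inner_complOp_iterate (h : AdjointContractions S T) (n : ℕ) (x y : V) :
    inner ℝ ((complOp S T)^[n] x) y = inner ℝ x ((complOp S T)^[n] y) := by
  induction n generalizing x y with
  | zero => rfl
  | succ n ih => rw [Function.iterate_succ_apply, ih, h.inner_complOp,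
      ← Function.iterate_succ_apply' (complOp S T)]

theorem norm_sq_iterate_antitone (h : AdjointContractions S T) (x : V) :
    Antitone fun n => ‖(complOp S T)^[n] x‖ ^ 2 := by
  refine antitone_nat_of_succ_le fun n => ?_
  rw [Function.iterate_succ_apply']
  nlinarith [h.norm_sq_complOp_add_le ((complOp S T)^[n] x),
    sq_nonneg ‖S ((complOp S T)^[n] x)‖]

theorem norm_sq_apply_iterate_antitone (h : AdjointContractions S T) (x : V) :
    Antitone fun n => ‖S ((complOp S T)^[n] x)‖ ^ 2 := by
  refine antitone_nat_of_succ_le fun n => ?_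
  rw [Function.iterate_succ_apply']
  exact h.norm_sq_apply_complOp_le _

/-- Each step loses at least ‖S Pⁱx‖², and these losses decrease in i, so n times the last one is
available. This yields decay of ‖S Pⁿx‖² like 1/n. -/
theorem norm_sq_iterate_add_le (h : AdjointContractions S T) (x : V) (n : ℕ) :
    ‖(complOp S T)^[n] x‖ ^ 2 + n * ‖S ((complOp S T)^[n] x)‖ ^ 2 ≤ ‖x‖ ^ 2 := by
  induction n with
  | zero => simp
  | succ n ih =>
    have h1 := h.norm_sq_complOp_add_le ((complOp S T)^[n] x)
    have h2 := h.norm_sq_apply_complOp_le ((complOp S T)^[n] x)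
    rw [Function.iterate_succ_apply']
    push_cast
    nlinarith [mul_le_mul_of_nonneg_left h2 (Nat.cast_nonneg (α := ℝ) n)]

theorem norm_sq_le_iterate (h : AdjointContractions S T) (x : V) (n : ℕ) :
    ‖x‖ ^ 2 ≤ ‖(complOp S T)^[n] x‖ ^ 2 + 2 * n * ‖S x‖ ^ 2 := by
  induction n with
  | zero => simp
  | succ n ih =>
    have h1 := h.norm_sq_le_complOp ((complOp S T)^[n] x)
    have h2 := h.norm_sq_apply_iterate_antitone x (Nat.zero_le n)
    simp only [Function.iterate_zero_apply] at h2
    rw [Function.iterate_succ_apply']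
    push_cast
    linarith

end AdjointContractions

/-- The norm lost by `x` under `n` applications of `1 - T S`. -/
def normDefect (S T : V →ₗ[ℝ] V) (n : ℕ) (x : V) : ℝ := ‖x‖ ^ 2 - ‖(complOp S T)^[n] x‖ ^ 2

theorem complOp_iterate_add (S T : V →ₗ[ℝ] V) (n : ℕ) (x y : V) :
    (complOp S T)^[n] (x + y) = (complOp S T)^[n] x + (complOp S T)^[n] y :=
  iterate_map_add _ _ _ _

theorem complOp_iterate_sub (S T : V →ₗ[ℝ] V) (n : ℕ) (x y : V) :
    (complOp S T)^[n] (x - y) = (complOp S T)^[n] x - (complOp S T)^[n] y :=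
  iterate_map_sub _ _ _ _

theorem norm_sq_add_add_sub (x y : V) :
    ‖x + y‖ ^ 2 + ‖x - y‖ ^ 2 = 2 * ‖x‖ ^ 2 + 2 * ‖y‖ ^ 2 := by
  rw [norm_add_sq_real, norm_sub_sq_real]; ring

namespace AdjointContractions

variable {S T : V →ₗ[ℝ] V}

theorem normDefect_mono (h : AdjointContractions S T) {m n : ℕ} (hmn : m ≤ n) (x : V) :
    normDefect S T m x ≤ normDefect S T n x := by
  have := h.norm_sq_iterate_antitone x hmn
  simp only [normDefect] at this ⊢
  linarith

theorem normDefect_nonneg (h : AdjointContractions S T) (n : ℕ) (x : V) :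
    0 ≤ normDefect S T n x := by
  have := h.normDefect_mono (Nat.zero_le n) x
  simpa [normDefect] using this

/-- The parallelogram law for a nonnegative quadratic form, with the term at x - y dropped. -/
theorem normDefect_add_le (h : AdjointContractions S T) (n : ℕ) (x y : V) :
    normDefect S T n (x + y) ≤ 2 * normDefect S T n x + 2 * normDefect S T n y := by
  have h1 := h.normDefect_nonneg n (x - y)
  have h2 := norm_sq_add_add_sub x y
  have h3 := norm_sq_add_add_sub ((complOp S T)^[n] x) ((complOp S T)^[n] y)
  rw [← complOp_iterate_add, ← complOp_iterate_sub] at h3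
  simp only [normDefect] at h1 ⊢
  linarith

/-- By monotonicity in the level, the difference of two defects is itself a nonnegative quadratic
form, so the parallelogram law applies to it. -/
theorem normDefect_sub_sub_le (h : AdjointContractions S T) {m n : ℕ} (hmn : m ≤ n) (x y : V) :
    normDefect S T n (x - y) - normDefect S T m (x - y) ≤
      2 * (normDefect S T n x - normDefect S T m x) +
      2 * (normDefect S T n y - normDefect S T m y) := by
  have h1 := h.normDefect_mono hmn (x + y)
  have h3 := norm_sq_add_add_sub ((complOp S T)^[n] x) ((complOp S T)^[n] y)
  have h4 := norm_sq_add_add_sub ((complOp S T)^[m] x) ((complOp S T)^[m] y)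
  rw [← complOp_iterate_add, ← complOp_iterate_sub] at h3 h4
  simp only [normDefect] at h1 ⊢
  linarith

theorem normDefect_le (h : AdjointContractions S T) (n : ℕ) (x : V) :
    normDefect S T n x ≤ 2 * n * ‖S x‖ ^ 2 := by
  have := h.norm_sq_le_iterate x n
  simp only [normDefect]
  linarith

theorem norm_sq_apply_le_normDefect (h : AdjointContractions S T) {n : ℕ} (hn : 1 ≤ n) (x : V) :
    ‖S x‖ ^ 2 ≤ normDefect S T n x := by
  have h1 := h.normDefect_mono hn x
  have h2 := h.norm_sq_complOp_add_le x
  simp only [normDefect, Function.iterate_one] at h1 ⊢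
  linarith

/-- Polarization; self-adjointness of P turns ⟨Pⁿx, Pⁿy⟩ into ⟨x, P²ⁿy⟩. -/
theorem normDefect_sub_eq (h : AdjointContractions S T) (n : ℕ) (x y : V) :
    normDefect S T n (x - y) = normDefect S T n x + normDefect S T n y
      - 2 * (inner ℝ x y - inner ℝ x ((complOp S T)^[n + n] y)) := by
  simp only [normDefect]
  rw [complOp_iterate_sub, norm_sub_sq_real, norm_sub_sq_real, Function.iterate_add_apply,
    h.inner_complOp_iterate]
  ring

end AdjointContractions

theorem complOp_iterate_comm {S T : V →ₗ[ℝ] V} {U : V →ₗᵢ[ℝ] V} (hS : ∀ x, S (U x) = U (S x))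
    (hT : ∀ x, T (U x) = U (T x)) (n : ℕ) (x : V) :
    (complOp S T)^[n] (U x) = U ((complOp S T)^[n] x) := by
  induction n with
  | zero => rfl
  | succ n ih =>
    rw [Function.iterate_succ_apply', ih, Function.iterate_succ_apply']
    simp [complOp, hS, hT]

theorem normDefect_comm {S T : V →ₗ[ℝ] V} {U : V →ₗᵢ[ℝ] V} (hS : ∀ x, S (U x) = U (S x))
    (hT : ∀ x, T (U x) = U (T x)) (n : ℕ) (x : V) :
    normDefect S T n (U x) = normDefect S T n x := by
  simp only [normDefect, complOp_iterate_comm hS hT, LinearIsometry.norm_map]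

end Contraction

/-! ### Translations and averages on ℓ²(G). -/

section Translations

open Finset

variable {G : Type*}

/-- Real square summable functions on `G`. -/
abbrev SquareSummable (G : Type*) : Type _ := lp (fun _ : G => ℝ) 2

theorem memlp_two_iff (f : G → ℝ) :
    Memℓp (E := fun _ : G => ℝ) f 2 ↔ Summable fun i => ‖f i‖ ^ 2 := by
  rw [memℓp_gen_iff (by norm_num)]
  norm_num

/-- Precomposition with a permutation, as an isometry of the square summable functions. -/
noncomputable def compPerm (σ : Equiv.Perm G) :
    SquareSummable G →ₗᵢ[ℝ] SquareSummable G where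
  toFun φ := ⟨fun z => φ (σ z), by
    have := (memlp_two_iff _).1 φ.2
    exact (memlp_two_iff _).2 ((σ.summable_iff (f := fun i => ‖φ i‖ ^ 2)).2 this)⟩
  map_add' _ _ := rfl
  map_smul' _ _ := rfl
  norm_map' φ := by
    have h : ∀ ψ : SquareSummable G, ‖ψ‖ ^ 2 = ∑' i, ψ i * ψ i := fun ψ => by
      rw [← real_inner_self_eq_norm_sq, lp.inner_eq_tsum]; rfl
    refine (sq_eq_sq₀ (norm_nonneg _) (norm_nonneg _)).1 ?_
    rw [h, h]
    exact σ.tsum_eq (fun i => φ i * φ i)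

@[simp] theorem compPerm_apply (σ : Equiv.Perm G) (φ : SquareSummable G) (z : G) :
    compPerm σ φ z = φ (σ z) := rfl

theorem inner_compPerm (σ : Equiv.Perm G) (φ ψ : SquareSummable G) :
    inner ℝ (compPerm σ φ) ψ = inner ℝ φ (compPerm σ⁻¹ ψ) := by
  rw [← (compPerm σ⁻¹).inner_map_map (compPerm σ φ)]
  congr 1
  ext z
  simp

theorem sum_sq_le_norm_sq (φ : SquareSummable G) (Z : Finset G) :
    ∑ z ∈ Z, φ z ^ 2 ≤ ‖φ‖ ^ 2 := by
  have := lp.sum_rpow_le_norm_rpow (p := 2) (by norm_num) φ Z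
  simpa using this

/-- The indicator function of a finite set as a square summable function. -/
noncomputable def indicatorL2 [DecidableEq G] (A : Finset G) : SquareSummable G :=
  ∑ a ∈ A, lp.single 2 a (1 : ℝ)

theorem indicatorL2_apply [DecidableEq G] (A : Finset G) (z : G) :
    indicatorL2 A z = if z ∈ A then 1 else 0 := by
  rw [indicatorL2, lp.coeFn_sum, Finset.sum_apply]
  simp [lp.single_apply, Pi.single_apply]

theorem inner_indicatorL2 [DecidableEq G] (A : Finset G) (φ : SquareSummable G) :
    inner ℝ (indicatorL2 A) φ = ∑ a ∈ A, φ a := by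
  rw [indicatorL2, sum_inner]
  refine Finset.sum_congr rfl fun a _ => ?_
  rw [lp.inner_single_left]
  simp

theorem norm_sq_indicatorL2 [DecidableEq G] (A : Finset G) : ‖indicatorL2 A‖ ^ 2 = A.card := by
  rw [← real_inner_self_eq_norm_sq, inner_indicatorL2]
  simp [indicatorL2_apply]

variable [Group G]

/-- Left translation on square summable functions. -/
noncomputable def leftTranslate (x : G) : SquareSummable G →ₗᵢ[ℝ] SquareSummable G :=
  compPerm (Equiv.mulLeft x⁻¹)

/-- Right translation on square summable functions. -/
noncomputable def rightTranslate (a : G) : SquareSummable G →ₗᵢ[ℝ] SquareSummable G :=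
  compPerm (Equiv.mulRight a)

@[simp] theorem leftTranslate_apply (x : G) (φ : SquareSummable G) (z : G) :
    leftTranslate x φ z = φ (x⁻¹ * z) := rfl

@[simp] theorem rightTranslate_apply (a : G) (φ : SquareSummable G) (z : G) :
    rightTranslate a φ z = φ (z * a) := rfl

theorem leftTranslate_mul (x y : G) (φ : SquareSummable G) :
    leftTranslate (x * y) φ = leftTranslate x (leftTranslate y φ) := by
  ext z; simp [mul_assoc]

theorem leftTranslate_one (φ : SquareSummable G) : leftTranslate 1 φ = φ := by
  ext z; simp

/-- The average of the right translations by the elements of `A`. -/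
noncomputable def rightAverage (A : Finset G) : SquareSummable G →ₗ[ℝ] SquareSummable G :=
  (A.card : ℝ)⁻¹ • ∑ a ∈ A, (rightTranslate a).toLinearMap

theorem rightAverage_eq (A : Finset G) (φ : SquareSummable G) :
    rightAverage A φ = (A.card : ℝ)⁻¹ • ∑ a ∈ A, rightTranslate a φ := by
  simp [rightAverage]

theorem norm_rightAverage_le (A : Finset G) (φ : SquareSummable G) :
    ‖rightAverage A φ‖ ≤ ‖φ‖ := by
  rw [rightAverage_eq, norm_smul, norm_inv, Real.norm_natCast]
  have h : ‖∑ a ∈ A, rightTranslate a φ‖ ≤ A.card * ‖φ‖ := by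
    refine (norm_sum_le _ _).trans ?_
    simp
  rcases A.eq_empty_or_nonempty with rfl | hA
  · simp
  · have : (0 : ℝ) < A.card := by exact_mod_cast hA.card_pos
    rw [inv_mul_le_iff₀ this]
    exact h

theorem rightAverage_leftTranslate (A : Finset G) (x : G) (φ : SquareSummable G) :
    rightAverage A (leftTranslate x φ) = leftTranslate x (rightAverage A φ) := by
  rw [rightAverage_eq, rightAverage_eq, map_smul, map_sum]
  congr 1
  refine Finset.sum_congr rfl fun a _ => ?_
  ext z
  simp [mul_assoc]

theorem rightAverage_apply (A : Finset G) (φ : SquareSummable G) (z : G) :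
    rightAverage A φ z = (A.card : ℝ)⁻¹ * ∑ a ∈ A, φ (z * a) := by
  rw [rightAverage_eq, lp.coeFn_smul, Pi.smul_apply, lp.coeFn_sum, Finset.sum_apply]
  simp

variable [DecidableEq G]

theorem adjointContractions_rightAverage (A : Finset G) :
    AdjointContractions (rightAverage A) (rightAverage A⁻¹) where
  inner_eq φ ψ := by
    rw [rightAverage_eq, rightAverage_eq, inner_smul_left, inner_smul_right, sum_inner,
      inner_sum, Finset.card_inv]
    congr 1
    have h : ∑ a ∈ A⁻¹, inner ℝ φ (rightTranslate a ψ) =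
        ∑ a ∈ A, inner ℝ φ (rightTranslate a⁻¹ ψ) := by
      refine Finset.sum_bij' (fun a _ => a⁻¹) (fun a _ => a⁻¹) ?_ ?_ ?_ ?_ ?_ <;> simp
    rw [h]
    refine Finset.sum_congr rfl fun a _ => ?_
    rw [rightTranslate, inner_compPerm]
    congr 1
  left_le := norm_rightAverage_le A
  right_le := norm_rightAverage_le A⁻¹

theorem inner_leftTranslate_indicatorL2 (A : Finset G) (hA : A.Nonempty) (z : G)
    (φ : SquareSummable G) :
    inner ℝ (leftTranslate z (indicatorL2 A)) φ = A.card * rightAverage A φ z := by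
  have h0 : (A.card : ℝ) ≠ 0 := by exact_mod_cast hA.card_pos.ne'
  rw [rightAverage_apply, mul_inv_cancel_left₀ h0, leftTranslate, inner_compPerm,
    inner_indicatorL2]
  refine Finset.sum_congr rfl fun a _ => ?_
  simp

theorem inner_leftTranslate_indicatorL2_self (A : Finset G) {z : G} (hz : z ∉ A * A⁻¹) :
    inner ℝ (leftTranslate z (indicatorL2 A)) (indicatorL2 A) = (0 : ℝ) := by
  rw [real_inner_comm, inner_indicatorL2]
  refine Finset.sum_eq_zero fun a ha => ?_
  rw [leftTranslate_apply, indicatorL2_apply, if_neg]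
  intro h
  apply hz
  rw [Finset.mem_mul]
  exact ⟨a, ha, (z⁻¹ * a)⁻¹, Finset.inv_mem_inv h, by group⟩

/-- Correlations with the translates of the indicator are the values of |A|·Sφ, so their squares sum
to at most the ℓ² norm squared. -/
theorem sum_sq_inner_leftTranslate_le (A : Finset G) (hA : A.Nonempty) (Z : Finset G)
    (φ : SquareSummable G) :
    ∑ z ∈ Z, (inner ℝ (leftTranslate z (indicatorL2 A)) φ : ℝ) ^ 2 ≤
      (A.card : ℝ) ^ 2 * ‖rightAverage A φ‖ ^ 2 := by
  simp only [inner_leftTranslate_indicatorL2 A hA, mul_pow]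
  rw [← Finset.mul_sum]
  exact mul_le_mul_of_nonneg_left (sum_sq_le_norm_sq _ _) (by positivity)

/-- The average of the indicator has total mass |A| on A A⁻¹; apply Cauchy–Schwarz there. -/
theorem card_sq_le_card_mul_norm_sq (A : Finset G) (hA : A.Nonempty) :
    (A.card : ℝ) ^ 2 ≤ (A * A⁻¹).card * ‖rightAverage A (indicatorL2 A)‖ ^ 2 := by
  have h0 : (A.card : ℝ) ≠ 0 := by exact_mod_cast hA.card_pos.ne'
  have h1 : ∑ z ∈ A * A⁻¹, rightAverage A (indicatorL2 A) z = A.card := by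
    simp only [rightAverage_apply]
    rw [← Finset.mul_sum, Finset.sum_comm]
    have : ∀ a ∈ A, ∑ z ∈ A * A⁻¹, indicatorL2 A (z * a) = (A.card : ℝ) := by
      intro a ha
      simp only [indicatorL2_apply]
      rw [Finset.sum_boole]
      congr 1
      refine Finset.card_bij' (fun z _ => z * a) (fun b _ => b * a⁻¹) ?_ ?_ ?_ ?_
      · intro z hz; exact (Finset.mem_filter.1 hz).2
      · intro b hb
        simp [Finset.mul_mem_mul hb (Finset.inv_mem_inv ha), hb]
      · simp
      · simp
    rw [Finset.sum_congr rfl this, Finset.sum_const, nsmul_eq_mul, inv_mul_cancel_left₀ h0]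
  calc (A.card : ℝ) ^ 2 = (∑ z ∈ A * A⁻¹, rightAverage A (indicatorL2 A) z) ^ 2 := by rw [h1]
    _ ≤ (A * A⁻¹).card * ∑ z ∈ A * A⁻¹, rightAverage A (indicatorL2 A) z ^ 2 :=
      sq_sum_le_card_mul_sum_sq
    _ ≤ _ := mul_le_mul_of_nonneg_left (sum_sq_le_norm_sq _ _) (by positivity)

/-- The same convolution seen from the left: an average of left translates, which is what random
sampling approximates. -/
theorem rightAverage_indicatorL2_eq (A : Finset G) :
    rightAverage A (indicatorL2 A) =
      (A.card : ℝ)⁻¹ • ∑ a ∈ A, leftTranslate a (indicatorL2 A⁻¹) := by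
  ext z
  rw [rightAverage_apply, lp.coeFn_smul, Pi.smul_apply, lp.coeFn_sum, Finset.sum_apply,
    smul_eq_mul]
  congr 1
  simp only [leftTranslate_apply, indicatorL2_apply, Finset.sum_boole]
  congr 1
  refine Finset.card_bij' (fun a _ => z * a) (fun b _ => z⁻¹ * b) ?_ ?_ ?_ ?_ <;>
    simp +contextual

end Translations

/-! ### Second moment of a random sample of vectors. -/

section Sampling

variable {V : Type*} [NormedAddCommGroup V] [InnerProductSpace ℝ V]

/-- Variances of independent mean-zero vectors add: the cross terms vanish on summing over the new
coordinate. -/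
theorem sum_norm_sq_sum_tuple_le {ι : Type*} [Fintype ι] {ζ : ι → V} (hζ : ∑ i, ζ i = 0)
    {C : ℝ} (hC : ∀ i, ‖ζ i‖ ^ 2 ≤ C) (m : ℕ) :
    ∑ τ : Fin m → ι, ‖∑ i, ζ (τ i)‖ ^ 2 ≤ m * (Fintype.card ι : ℝ) ^ m * C := by
  induction m with
  | zero => simp
  | succ m ih =>
    rw [← (Fin.consEquiv fun _ : Fin (m + 1) => ι).sum_comp, Fintype.sum_prod_type_right]
    have h1 : ∀ τ : Fin m → ι, ∑ a, ‖∑ i, ζ ((Fin.consEquiv fun _ => ι) (a, τ) i)‖ ^ 2 ≤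
        Fintype.card ι * C + Fintype.card ι * ‖∑ i, ζ (τ i)‖ ^ 2 := by
      intro τ
      have h2 : ∀ a, ‖∑ i, ζ ((Fin.consEquiv fun _ => ι) (a, τ) i)‖ ^ 2 =
          ‖ζ a‖ ^ 2 + 2 * inner ℝ (ζ a) (∑ i, ζ (τ i)) + ‖∑ i, ζ (τ i)‖ ^ 2 := by
        intro a
        rw [← norm_add_sq_real, Fin.sum_univ_succ]
        rfl
      simp only [h2, Finset.sum_add_distrib]
      rw [← Finset.mul_sum, ← sum_inner, hζ, inner_zero_left]
      have h3 : ∑ a, ‖ζ a‖ ^ 2 ≤ Fintype.card ι * C := by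
        refine (Finset.sum_le_sum fun a _ => hC a).trans ?_
        simp
      simp only [Finset.sum_const, Finset.card_univ, nsmul_eq_mul]
      linarith
    refine (Finset.sum_le_sum fun τ _ => h1 τ).trans ?_
    rw [Finset.sum_add_distrib, ← Finset.mul_sum Finset.univ (fun τ : Fin m → ι => ‖∑ i, ζ (τ i)‖ ^ 2)]
    have h4 := mul_le_mul_of_nonneg_left ih (Nat.cast_nonneg (α := ℝ) (Fintype.card ι))
    simp only [Finset.sum_const, Finset.card_univ, Fintype.card_fun, Fintype.card_fin,
      nsmul_eq_mul]
    push_cast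
    have h5 : (Fintype.card ι : ℝ) ^ (m + 1) = Fintype.card ι ^ m * Fintype.card ι := pow_succ _ _
    rw [h5]
    nlinarith

theorem card_le_two_mul_card_filter {Ω : Type*} [Fintype Ω] {g : Ω → ℝ} (hg : ∀ ω, 0 ≤ g ω)
    {c : ℝ} (hc : 0 < c) (h : ∑ ω, g ω ≤ Fintype.card Ω * c) :
    (Fintype.card Ω : ℝ) ≤ 2 * (Finset.univ.filter fun ω => g ω ≤ 2 * c).card := by
  have h1 : ((Finset.univ.filter fun ω => ¬ g ω ≤ 2 * c).card : ℝ) * (2 * c) ≤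
      Fintype.card Ω * c := by
    refine le_trans ?_ h
    rw [← nsmul_eq_mul, ← Finset.sum_const]
    exact (Finset.sum_le_sum fun ω hω => (not_le.1 (Finset.mem_filter.1 hω).2).le).trans
      (Finset.sum_le_univ_sum_of_nonneg hg)
  have h2 : ((Finset.univ.filter fun ω => ¬ g ω ≤ 2 * c).card : ℝ) * 2 ≤ Fintype.card Ω := by
    refine le_of_mul_le_mul_right ?_ hc
    linarith
  have h3 := Finset.card_filter_add_card_filter_not (s := (Finset.univ : Finset Ω))
    (fun ω => g ω ≤ 2 * c)
  rw [Finset.card_univ] at h3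
  have h4 : ((Finset.univ.filter fun ω => g ω ≤ 2 * c).card : ℝ) +
      (Finset.univ.filter fun ω => ¬ g ω ≤ 2 * c).card = Fintype.card Ω := by exact_mod_cast h3
  linarith

theorem card_pow_le_two_mul_card_filter {ι : Type*} [Fintype ι] {ζ : ι → V}
    (hζ : ∑ i, ζ i = 0) {C : ℝ} (hC0 : 0 < C) (hC : ∀ i, ‖ζ i‖ ^ 2 ≤ C) {m : ℕ} (hm : 0 < m) :
    (Fintype.card ι : ℝ) ^ m ≤
      2 * (Finset.univ.filter fun τ : Fin m → ι => ‖∑ i, ζ (τ i)‖ ^ 2 ≤ 2 * (m * C)).card := by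
  classical
  have hm' : (0 : ℝ) < m := by exact_mod_cast hm
  have h1 : (Fintype.card (Fin m → ι) : ℝ) = (Fintype.card ι : ℝ) ^ m := by
    rw [Fintype.card_fun, Fintype.card_fin]; push_cast; rfl
  have h2 := sum_norm_sq_sum_tuple_le hζ hC m
  rw [← h1]
  convert card_le_two_mul_card_filter (fun τ : Fin m → ι => sq_nonneg ‖∑ i, ζ (τ i)‖)
    (mul_pos hm' hC0) ?_
  rw [h1]
  linarith

end Sampling

/-! ### Croot–Sisask almost periods. -/

section AlmostPeriods

variable {G : Type*} [Group G] [DecidableEq G]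

/-- Many group elements nearly fix the average of a family of left translates. -/
theorem exists_almostPeriods {K : ℝ} {A : Finset G} (hA : A.Nonempty)
    (hK : ((A⁻¹ * A).card : ℝ) ≤ K * A.card) {m : ℕ} (hm : 0 < m) :
    ∃ D : Finset G, (A.card : ℝ) ≤ 2 * K ^ m * D.card ∧
      ∀ x ∈ D, ‖rightAverage A (leftTranslate x (indicatorL2 A) - indicatorL2 A)‖ ^ 2 ≤
        32 * A.card / m := by
  classical
  have hA0 : (0 : ℝ) < A.card := by exact_mod_cast hA.card_pos
  have hm0 : (0 : ℝ) < m := by exact_mod_cast hm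
  set s := rightAverage A (indicatorL2 A) with hs
  set w := indicatorL2 A⁻¹ with hw
  have hw2 : ‖w‖ ^ 2 = A.card := by rw [hw, norm_sq_indicatorL2, Finset.card_inv]
  have hs2 : ‖s‖ ^ 2 ≤ A.card := by
    rw [← norm_sq_indicatorL2 A]
    exact pow_le_pow_left₀ (norm_nonneg _) (norm_rightAverage_le _ _) 2
  set ζ : A → SquareSummable G := fun a => leftTranslate (a : G) w - s with hζdef
  have hζ : ∑ a, ζ a = 0 := by
    simp only [hζdef, Finset.sum_sub_distrib, Finset.sum_const, Finset.card_univ,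
      Fintype.card_coe]
    rw [Finset.sum_coe_sort A (fun a => leftTranslate a w), hs, rightAverage_indicatorL2_eq,
      ← Nat.cast_smul_eq_nsmul ℝ, smul_smul, mul_inv_cancel₀ hA0.ne', one_smul, sub_self]
  have hC : ∀ a, ‖ζ a‖ ^ 2 ≤ 4 * A.card := by
    intro a
    have h1 := norm_sq_add_add_sub (leftTranslate (a : G) w) s
    rw [LinearIsometry.norm_map, hw2] at h1
    have h2 := sq_nonneg ‖leftTranslate (a : G) w + s‖
    simp only [hζdef]
    linarith
  have hL := card_pow_le_two_mul_card_filter hζ (by positivity) hC hm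
  set L := Finset.univ.filter fun τ : Fin m → A => ‖∑ i, ζ (τ i)‖ ^ 2 ≤ 2 * (m * (4 * A.card))
  rw [Fintype.card_coe] at hL
  set T := Fintype.piFinset fun _ : Fin m => A⁻¹ * A with hT
  have hTcard : (T.card : ℝ) = ((A⁻¹ * A).card : ℝ) ^ m := by
    rw [hT, Fintype.card_piFinset_const]; push_cast; rfl
  have hBne : (A⁻¹ * A).Nonempty := hA.inv.mul hA
  have hB0 : (0 : ℝ) < (A⁻¹ * A).card := by exact_mod_cast hBne.card_pos
  have hT0 : (0 : ℝ) < T.card := by rw [hTcard]; positivity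
  have hTne : T.Nonempty := by
    rw [← Finset.card_pos]; exact_mod_cast hT0
  have hL0 : (0 : ℝ) < L.card := by
    have : (0 : ℝ) < (A.card : ℝ) ^ m := by positivity
    linarith
  -- Shifting good tuples by y ∈ A⁻¹ lands in (A⁻¹A)^m, so some tuple σ is hit at least
  -- |A||L|/|A⁻¹A|^m times. All the corresponding translates of s are then close to the one average
  -- along σ, hence to each other.
  set f : G × (Fin m → A) → (Fin m → G) := fun p i => p.1 * p.2 i with hf
  obtain ⟨σ, -, hσ⟩ := Finset.exists_le_card_fiber_of_nsmul_le_card_of_maps_to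
    (s := A⁻¹ ×ˢ L) (t := T) (f := f) (b := (A.card * L.card / T.card : ℝ)) (by
      rintro ⟨y, τ⟩ hp
      rw [hT, Fintype.mem_piFinset]
      exact fun i => Finset.mul_mem_mul (Finset.mem_product.1 hp).1 (τ i).2) hTne (by
      rw [nsmul_eq_mul, mul_div_cancel₀ _ hT0.ne', Finset.card_product, Finset.card_inv]
      push_cast; rfl)
  set F := (A⁻¹ ×ˢ L).filter fun p => f p = σ with hF
  have hF0 : 0 < F.card := by
    have : (0 : ℝ) < A.card * L.card / T.card := by positivity
    exact_mod_cast this.trans_le hσ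
  obtain ⟨p₀, hp₀⟩ := Finset.card_pos.1 hF0
  have hnear : ∀ p ∈ F, ‖(∑ i, leftTranslate (σ i) w) - (m : ℝ) • leftTranslate p.1 s‖ ^ 2 ≤
      8 * m * A.card := by
    rintro ⟨y, τ⟩ hp
    obtain ⟨hp1, hp2⟩ := Finset.mem_filter.1 hp
    have hτ := (Finset.mem_filter.1 (Finset.mem_product.1 hp1).2).2
    have h1 : (∑ i, leftTranslate (σ i) w) - (m : ℝ) • leftTranslate y s =
        leftTranslate y (∑ i, ζ (τ i)) := by
      simp only [hζdef, ← hp2, hf, leftTranslate_mul, map_sum, map_sub, Finset.sum_sub_distrib,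
        Finset.sum_const, Finset.card_univ, Fintype.card_fin, Nat.cast_smul_eq_nsmul, map_nsmul]
    rw [h1, LinearIsometry.norm_map]
    linarith
  refine ⟨F.image fun p => p₀.1⁻¹ * p.1, ?_, ?_⟩
  · rw [Finset.card_image_of_injOn]
    · have h1 : (T.card : ℝ) ≤ K ^ m * A.card ^ m := by
        rw [hTcard, ← mul_pow]
        exact pow_le_pow_left₀ hB0.le hK m
      rw [div_le_iff₀ hT0] at hσ
      have h2 : (A.card : ℝ) * A.card ^ m ≤ 2 * K ^ m * F.card * A.card ^ m := by
        have h3 := mul_le_mul_of_nonneg_left hL hA0.le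
        have h4 := mul_le_mul_of_nonneg_left h1 (Nat.cast_nonneg (α := ℝ) F.card)
        linarith
      exact le_of_mul_le_mul_right h2 (by positivity)
    -- Within the fibre over σ, the shift y determines τ.
    · rintro ⟨y, τ⟩ hp ⟨y', τ'⟩ hp' h
      have hy : y = y' := mul_left_cancel h
      subst hy
      have h1 := (Finset.mem_filter.1 (Finset.mem_coe.1 hp)).2
      have h2 := (Finset.mem_filter.1 (Finset.mem_coe.1 hp')).2
      have h3 := h1.trans h2.symm
      congr 1
      ext i
      exact mul_left_cancel (congrFun h3 i)
  · intro x hx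
    obtain ⟨p, hp, rfl⟩ := Finset.mem_image.1 hx
    have h1 := hnear p hp
    have h0 := hnear p₀ hp₀
    set u := ∑ i, leftTranslate (σ i) w
    have h2 := norm_sq_add_add_sub (u - (m : ℝ) • leftTranslate p₀.1 s)
      (u - (m : ℝ) • leftTranslate p.1 s)
    have h3 : (u - (m : ℝ) • leftTranslate p₀.1 s) - (u - (m : ℝ) • leftTranslate p.1 s) =
        (m : ℝ) • (leftTranslate p₀.1 (leftTranslate (p₀.1⁻¹ * p.1) s - s)) := by
      rw [map_sub, ← leftTranslate_mul, mul_inv_cancel_left, smul_sub]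
      abel
    rw [h3, norm_smul, LinearIsometry.norm_map, Real.norm_natCast, mul_pow] at h2
    rw [map_sub, rightAverage_leftTranslate, le_div_iff₀ hm0]
    refine le_of_mul_le_mul_right ?_ hm0
    nlinarith [sq_nonneg ‖(u - (m : ℝ) • leftTranslate p₀.1 s) +
      (u - (m : ℝ) • leftTranslate p.1 s)‖]

end AlmostPeriods

/-! ### Displacement, choice of scales, and sets with small doubling on both sides. -/

section Core

variable {G : Type*} [Group G] [DecidableEq G]

/-- The displacement of the indicator function of `A` by the left translation by `x`, measured
by the norm defect at level `n`. -/
noncomputable def displacement (A : Finset G) (n : ℕ) (x : G) : ℝ :=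
  normDefect (rightAverage A) (rightAverage A⁻¹) n
    (leftTranslate x (indicatorL2 A) - indicatorL2 A)

theorem normDefect_leftTranslate (A : Finset G) (n : ℕ) (x : G) (φ : SquareSummable G) :
    normDefect (rightAverage A) (rightAverage A⁻¹) n (leftTranslate x φ) =
      normDefect (rightAverage A) (rightAverage A⁻¹) n φ :=
  normDefect_comm (rightAverage_leftTranslate A x) (rightAverage_leftTranslate A⁻¹ x) n φ

theorem normDefect_neg {V : Type*} [NormedAddCommGroup V] [InnerProductSpace ℝ V]
    (S T : V →ₗ[ℝ] V) (n : ℕ) (x : V) : normDefect S T n (-x) = normDefect S T n x := by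
  have h : (complOp S T)^[n] (-x) = -(complOp S T)^[n] x := iterate_map_neg _ _ _
  simp only [normDefect, h, norm_neg]

theorem displacement_one (A : Finset G) (n : ℕ) : displacement A n 1 = 0 := by
  have h : (complOp (rightAverage A) (rightAverage A⁻¹))^[n] 0 = 0 := iterate_map_zero _ _
  simp [displacement, leftTranslate_one, normDefect, h]

theorem displacement_inv (A : Finset G) (n : ℕ) (x : G) :
    displacement A n x⁻¹ = displacement A n x := by
  rw [displacement, ← normDefect_leftTranslate A n x, map_sub, ← leftTranslate_mul,
    mul_inv_cancel, leftTranslate_one, ← neg_sub, normDefect_neg]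
  rfl

/-- xyv - v = (xv - v) + x(yv - v), and the defect is invariant under left translation. -/
theorem displacement_mul_le (A : Finset G) (n : ℕ) (x y : G) :
    displacement A n (x * y) ≤ 2 * displacement A n x + 2 * displacement A n y := by
  have h := (adjointContractions_rightAverage A).normDefect_add_le n
    (leftTranslate x (indicatorL2 A) - indicatorL2 A)
    (leftTranslate x (leftTranslate y (indicatorL2 A) - indicatorL2 A))
  rw [normDefect_leftTranslate, map_sub, ← leftTranslate_mul, sub_add_sub_cancel'] at h
  exact h

theorem displacement_list_prod_le (A : Finset G) (n : ℕ) {δ : ℝ} (hδ : 0 ≤ δ) (l : List G)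
    (hl : ∀ x ∈ l, displacement A n x ≤ δ) :
    displacement A n l.prod ≤ 4 ^ l.length * δ := by
  induction l with
  | nil => simpa [displacement_one] using hδ
  | cons x l ih =>
    have h1 := ih fun y hy => hl y (List.mem_cons_of_mem _ hy)
    have h2 := hl x List.mem_cons_self
    have h3 := displacement_mul_le A n x l.prod
    have h4 : (1 : ℝ) ≤ 4 ^ l.length := one_le_pow₀ (by norm_num)
    rw [List.prod_cons, List.length_cons, pow_succ]
    nlinarith

/-- Level m is controlled by the average directly; the growth from m to n costs only the growth of
the defect of the indicator, whatever x is. -/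
theorem displacement_le (A : Finset G) {m n : ℕ} (hmn : m ≤ n) (x : G) :
    displacement A n x ≤
      2 * m * ‖rightAverage A (leftTranslate x (indicatorL2 A) - indicatorL2 A)‖ ^ 2 +
      4 * (normDefect (rightAverage A) (rightAverage A⁻¹) n (indicatorL2 A) -
        normDefect (rightAverage A) (rightAverage A⁻¹) m (indicatorL2 A)) := by
  have h := adjointContractions_rightAverage A
  have h1 := h.normDefect_sub_sub_le hmn (leftTranslate x (indicatorL2 A)) (indicatorL2 A)
  have h2 := h.normDefect_le m (leftTranslate x (indicatorL2 A) - indicatorL2 A)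
  simp only [normDefect_leftTranslate] at h1
  rw [displacement]
  linarith

/-- Few elements outside `A * A⁻¹` displace the indicator function of `A` by little. -/
theorem card_mul_le_of_displacement_le {K : ℝ} (hK0 : 0 < K) {A : Finset G} (hA : A.Nonempty)
    (hK : ((A * A⁻¹).card : ℝ) ≤ K * A.card) {n : ℕ} (hn : 1 ≤ n) (Z : Finset G)
    (hZ : ∀ z ∈ Z, z ∉ A * A⁻¹ ∧ K * displacement A n z ≤ A.card) :
    (Z.card : ℝ) * n ≤ 2 * K ^ 2 * A.card := by
  have h := adjointContractions_rightAverage A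
  have hA0 : (0 : ℝ) < A.card := by exact_mod_cast hA.card_pos
  set v := indicatorL2 A with hv
  set u := (complOp (rightAverage A) (rightAverage A⁻¹))^[n + n] v with hu
  have h1 : (A.card : ℝ) ≤ K * normDefect (rightAverage A) (rightAverage A⁻¹) n v := by
    have h2 := card_sq_le_card_mul_norm_sq A hA
    have h3 := h.norm_sq_apply_le_normDefect hn v
    have h4 := mul_le_mul_of_nonneg_right hK (sq_nonneg ‖rightAverage A v‖)
    have h5 : (A.card : ℝ) * A.card ≤ A.card * (K * ‖rightAverage A v‖ ^ 2) := by nlinarith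
    have h6 := le_of_mul_le_mul_left h5 hA0
    nlinarith
  have h2 : ∀ z ∈ Z, (A.card : ℝ) ^ 2 ≤ 4 * K ^ 2 * (inner ℝ (leftTranslate z v) u : ℝ) ^ 2 := by
    intro z hz
    obtain ⟨hz1, hz2⟩ := hZ z hz
    have h3 := h.normDefect_sub_eq n (leftTranslate z v) v
    rw [inner_leftTranslate_indicatorL2_self A hz1, normDefect_leftTranslate, ← hu] at h3
    rw [displacement, h3] at hz2
    -- By orthogonality the displacement is 2Q_n(v) + 2⟨zv, u⟩, while K·Q_n(v) ≥ |A|.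
    have h4 : (A.card : ℝ) ≤ -(2 * K * inner ℝ (leftTranslate z v) u) := by linarith
    have h5 := pow_le_pow_left₀ hA0.le h4 2
    linarith
  have h3 := Finset.sum_le_sum h2
  rw [Finset.sum_const, nsmul_eq_mul, ← Finset.mul_sum] at h3
  have h4 := sum_sq_inner_leftTranslate_le A hA Z u
  have h5 := h.norm_sq_iterate_add_le v (n + n)
  rw [← hu, hv, norm_sq_indicatorL2] at h5
  push_cast at h5
  have h6 : 2 * (n : ℝ) * ‖rightAverage A u‖ ^ 2 ≤ A.card := by nlinarith [sq_nonneg ‖u‖]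
  have h7 : (Z.card : ℝ) * A.card ^ 2 ≤ 4 * K ^ 2 * (A.card ^ 2 * ‖rightAverage A u‖ ^ 2) :=
    h3.trans (mul_le_mul_of_nonneg_left h4 (by positivity))
  have h8 : (Z.card : ℝ) ≤ 4 * K ^ 2 * ‖rightAverage A u‖ ^ 2 := by
    refine le_of_mul_le_mul_right ?_ (pow_pos hA0 2)
    linarith
  have h9 := mul_le_mul_of_nonneg_left h6 (by positivity : (0 : ℝ) ≤ 2 * K ^ 2)
  have h10 := mul_le_mul_of_nonneg_right h8 (Nat.cast_nonneg (α := ℝ) n)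
  linarith

theorem card_tuplesWithProdIn_succ (k : ℕ) (D B : Finset G) :
    (tuplesWithProdIn (k + 1) D B).card = ∑ d ∈ Fintype.piFinset fun _ : Fin k => D,
      (D.filter fun x => x * (List.ofFn d).prod ∈ B).card := by
  have h : (tuplesWithProdIn (k + 1) D B).card =
      ((D ×ˢ Fintype.piFinset fun _ : Fin k => D).filter
        fun p => p.1 * (List.ofFn p.2).prod ∈ B).card := by
    symm
    refine Finset.card_bij' (fun p _ => (Fin.cons p.1 p.2 : Fin (k + 1) → G))
      (fun d _ => (d 0, Fin.tail d)) ?_ ?_ ?_ ?_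
    · rintro ⟨x, d⟩ hp
      simp only [Finset.mem_filter, Finset.mem_product, Fintype.mem_piFinset] at hp
      simp only [tuplesWithProdIn, Finset.mem_filter, Fintype.mem_piFinset]
      refine ⟨fun i => ?_, ?_⟩
      · refine Fin.cases ?_ (fun j => ?_) i
        · simpa using hp.1.1
        · simpa using hp.1.2 j
      · simpa [List.ofFn_succ] using hp.2
    · intro d hd
      simp only [tuplesWithProdIn, Finset.mem_filter, Fintype.mem_piFinset] at hd
      simp only [Finset.mem_filter, Finset.mem_product, Fintype.mem_piFinset]
      refine ⟨⟨hd.1 0, fun j => hd.1 j.succ⟩, ?_⟩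
      have h := hd.2
      rw [List.ofFn_succ, List.prod_cons] at h
      exact h
    · rintro ⟨x, d⟩ _
      simp
    · intro d _
      simp
  rw [h, Finset.card_filter, Finset.sum_product_right]
  simp only [Finset.card_filter]

/-- Three scales at which the norm defect of the indicator function is well behaved produce a
centred set most of whose products stay in `A * A⁻¹`. -/
theorem exists_isCentred_of_scales {K ε δ θ : ℝ} (hK1 : 1 ≤ K) (hδ : 0 < δ) (hθ0 : 0 < θ)
    (hθ : θ ≤ 1 / 2) (hθε : 2 * θ ≤ ε) {k₀ : ℕ} (hδK : K * (4 ^ k₀ * δ) ≤ 1)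
    {A : Finset G} (hA : A.Nonempty) (hAA : ((A * A⁻¹).card : ℝ) ≤ K * A.card)
    (hAA' : ((A⁻¹ * A).card : ℝ) ≤ K * A.card) {n N m : ℕ} (hn : 1 ≤ n) (hnN : n ≤ N)
    (hm0 : 0 < m) (hm : 128 * n ≤ δ * m) (hN : 4 * K ^ (m + 2) ≤ θ * N)
    (hsmall : 8 * (normDefect (rightAverage A) (rightAverage A⁻¹) N (indicatorL2 A) -
        normDefect (rightAverage A) (rightAverage A⁻¹) n (indicatorL2 A)) ≤ δ * A.card) :
    ∃ D : Finset G, IsCentred D ∧ D ⊆ A * A⁻¹ ∧ (A.card : ℝ) ≤ 4 * K ^ m * D.card ∧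
      ∀ k : ℕ, 1 ≤ k → k ≤ k₀ →
        (1 - ε) * (D.card : ℝ) ^ k ≤ ((tuplesWithProdIn k D (A * A⁻¹)).card : ℝ) := by
  classical
  have hA0 : (0 : ℝ) < A.card := by exact_mod_cast hA.card_pos
  have hK0 : 0 < K := by linarith
  have hN0 : (0 : ℝ) < N := by exact_mod_cast hn.trans hnN
  have hm0' : (0 : ℝ) < m := by exact_mod_cast hm0
  obtain ⟨P, hPcard, hP⟩ := exists_almostPeriods hA hAA' hm0
  have hPd : ∀ x ∈ P, displacement A N x ≤ δ * A.card := by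
    intro x hx
    have h1 := displacement_le A hnN x
    have h2 := mul_le_mul_of_nonneg_left (hP x hx) (by positivity : (0 : ℝ) ≤ 2 * n)
    -- Half of the budget δ|A| goes to the sampling error, the other half to `hsmall`.
    have h3 : 2 * (n : ℝ) * (32 * A.card / m) ≤ δ * A.card / 2 := by
      rw [mul_div_assoc', div_le_iff₀ hm0']
      have := mul_le_mul_of_nonneg_right hm hA0.le
      linarith
    linarith
  have h4k : ∀ k ≤ k₀, K * (4 ^ k * (δ * A.card)) ≤ A.card := by
    intro k hk
    have h1 : (4 : ℝ) ^ k ≤ 4 ^ k₀ := pow_le_pow_right₀ (by norm_num) hk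
    have h2 : K * (4 ^ k * δ) ≤ 1 :=
      (mul_le_mul_of_nonneg_left (mul_le_mul_of_nonneg_right h1 hδ.le) hK0.le).trans hδK
    have h3 := mul_le_mul_of_nonneg_right h2 hA0.le
    linarith
  have hbad : ∀ Z : Finset G, (∀ z ∈ Z, z ∉ A * A⁻¹ ∧ K * displacement A N z ≤ A.card) →
      (Z.card : ℝ) ≤ θ * P.card := by
    intro Z hZ
    have h1 := card_mul_le_of_displacement_le hK0 hA hAA (hn.trans hnN) Z hZ
    have h2 : 2 * K ^ 2 * (A.card : ℝ) ≤ θ * P.card * N := by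
      have h3 := mul_le_mul_of_nonneg_left hPcard (by positivity : 0 ≤ 2 * K ^ 2)
      have h4 := mul_le_mul_of_nonneg_right hN (Nat.cast_nonneg (α := ℝ) P.card)
      rw [pow_add] at h4
      linarith
    exact le_of_mul_le_mul_right (h1.trans h2) hN0
  -- The whole sublevel set, unlike the almost periods, is visibly centred; it still contains at
  -- least half of them.
  set D := (A * A⁻¹).filter fun x => displacement A N x ≤ δ * A.card with hD
  have hDd : ∀ x ∈ D, displacement A N x ≤ δ * A.card := fun x hx => (Finset.mem_filter.1 hx).2
  have hPD : (P.card : ℝ) ≤ 2 * D.card := by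
    have h1 : ((P.filter fun x => ¬ x ∈ A * A⁻¹).card : ℝ) ≤ θ * P.card := by
      refine hbad _ fun z hz => ⟨(Finset.mem_filter.1 hz).2, ?_⟩
      have h2 := hPd z (Finset.mem_filter.1 hz).1
      have h3 := h4k 0 (Nat.zero_le _)
      rw [pow_zero, one_mul] at h3
      exact (mul_le_mul_of_nonneg_left h2 hK0.le).trans h3
    have h2 : (P.filter fun x => x ∈ A * A⁻¹).card ≤ D.card := by
      refine Finset.card_le_card fun x hx => ?_
      exact Finset.mem_filter.2 ⟨(Finset.mem_filter.1 hx).2, hPd x (Finset.mem_filter.1 hx).1⟩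
    have h3 := Finset.card_filter_add_card_filter_not (s := P) (fun x => x ∈ A * A⁻¹)
    have h4 : ((P.filter fun x => x ∈ A * A⁻¹).card : ℝ) +
      (P.filter fun x => ¬ x ∈ A * A⁻¹).card = P.card := by exact_mod_cast h3
    have h5 : ((P.filter fun x => x ∈ A * A⁻¹).card : ℝ) ≤ D.card := by exact_mod_cast h2
    nlinarith
  refine ⟨D, ⟨?_, ?_⟩, Finset.filter_subset _ _, ?_, ?_⟩
  · obtain ⟨a, ha⟩ := hA
    refine Finset.mem_filter.2 ⟨?_, ?_⟩
    · rw [← mul_inv_cancel a]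
      exact Finset.mul_mem_mul ha (Finset.inv_mem_inv ha)
    · rw [displacement_one]; positivity
  · ext x
    have h1 : x⁻¹ ∈ A * A⁻¹ ↔ x ∈ A * A⁻¹ := by
      rw [← Finset.mem_inv', mul_inv_rev, inv_inv]
    rw [Finset.mem_inv', hD, Finset.mem_filter, Finset.mem_filter, displacement_inv, h1]
  · have := mul_le_mul_of_nonneg_left hPD (by positivity : 0 ≤ 2 * K ^ m)
    linarith
  · intro k hk1 hk
    obtain ⟨k, rfl⟩ := Nat.exists_eq_add_of_le' hk1
    rw [card_tuplesWithProdIn_succ]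
    push_cast
    have h1 : ∀ d ∈ Fintype.piFinset fun _ : Fin k => D, (1 - ε) * (D.card : ℝ) ≤
        (D.filter fun x => x * (List.ofFn d).prod ∈ A * A⁻¹).card := by
      intro d hd
      have h2 : (((D.filter fun x => ¬ x * (List.ofFn d).prod ∈ A * A⁻¹).image
          fun x => x * (List.ofFn d).prod).card : ℝ) ≤ θ * P.card := by
        refine hbad _ fun z hz => ?_
        obtain ⟨x, hx, rfl⟩ := Finset.mem_image.1 hz
        obtain ⟨hx1, hx2⟩ := Finset.mem_filter.1 hx
        refine ⟨hx2, ?_⟩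
        have h3 := displacement_list_prod_le A N (by positivity : 0 ≤ δ * A.card)
          (x :: List.ofFn d) (by
            intro y hy
            rcases List.mem_cons.1 hy with rfl | hy
            · exact hDd _ hx1
            · obtain ⟨i, rfl⟩ := (List.mem_ofFn' _ _).1 hy
              exact hDd _ (Fintype.mem_piFinset.1 hd i))
        rw [List.prod_cons, List.length_cons, List.length_ofFn] at h3
        exact (mul_le_mul_of_nonneg_left h3 hK0.le).trans (h4k _ hk)
      -- With the last k factors fixed, distinct first factors give distinct bad products, so at
      -- most θ|P| ≤ 2θ|D| ≤ ε|D| of them are bad.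
      rw [Finset.card_image_of_injective _ (mul_left_injective _)] at h2
      have h3 := Finset.card_filter_add_card_filter_not (s := D)
        (fun x => x * (List.ofFn d).prod ∈ A * A⁻¹)
      have h4 : ((D.filter fun x => x * (List.ofFn d).prod ∈ A * A⁻¹).card : ℝ) +
        (D.filter fun x => ¬ x * (List.ofFn d).prod ∈ A * A⁻¹).card = D.card := by
        exact_mod_cast h3
      have h5 := mul_le_mul_of_nonneg_left hPD hθ0.le
      have h6 := mul_le_mul_of_nonneg_right hθε (Nat.cast_nonneg (α := ℝ) D.card)
      linarith
    have h2 := Finset.sum_le_sum h1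
    rw [Finset.sum_const, Fintype.card_piFinset_const, nsmul_eq_mul] at h2
    push_cast at h2
    rw [pow_succ]
    linarith

/-- A sequence with bounded total increment has a small increment early on. -/
theorem exists_lt_sub_le {e : ℕ → ℝ} {C : ℝ} {I : ℕ} (hI : 0 < I) (h : e I - e 0 ≤ C) :
    ∃ i < I, I * (e (i + 1) - e i) ≤ C := by
  by_contra! hcon
  have hI0 : (0 : ℝ) < I := by exact_mod_cast hI
  have h1 : ∑ i ∈ Finset.range I, C / I < ∑ i ∈ Finset.range I, (e (i + 1) - e i) := by
    refine Finset.sum_lt_sum_of_nonempty (by simpa using hI.ne') fun i hi => ?_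
    rw [div_lt_iff₀' hI0]
    exact hcon i (Finset.mem_range.1 hi)
  rw [Finset.sum_range_sub, Finset.sum_const, Finset.card_range, nsmul_eq_mul,
    mul_div_cancel₀ _ hI0.ne'] at h1
  linarith

/-- The case of sets with small doubling on both sides. -/
theorem exists_isCentred_of_two_sided {K : ℝ} (hK1 : 1 ≤ K) (k₀ : ℕ) {ε : ℝ} (hε : 0 < ε) :
    ∃ c : ℝ, 0 < c ∧
      ∀ (G : Type*) [Group G] [DecidableEq G] (A : Finset G), A.Nonempty →
        ((A * A⁻¹).card : ℝ) ≤ K * (A.card : ℝ) → ((A⁻¹ * A).card : ℝ) ≤ K * (A.card : ℝ) →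
        ∃ D : Finset G, IsCentred D ∧ D ⊆ A * A⁻¹ ∧ c * (A.card : ℝ) ≤ (D.card : ℝ) ∧
          ∀ k : ℕ, 1 ≤ k → k ≤ k₀ →
            (1 - ε) * (D.card : ℝ) ^ k ≤ ((tuplesWithProdIn k D (A * A⁻¹)).card : ℝ) := by
  have hK0 : 0 < K := by linarith
  obtain ⟨δ, hδ, hδK⟩ : ∃ δ : ℝ, 0 < δ ∧ K * (4 ^ k₀ * δ) ≤ 1 :=
    ⟨1 / (K * 4 ^ k₀), by positivity, le_of_eq (by field_simp)⟩
  obtain ⟨θ, hθ0, hθ, hθε⟩ : ∃ θ : ℝ, 0 < θ ∧ θ ≤ 1 / 2 ∧ 2 * θ ≤ ε :=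
    ⟨min (1 / 2) (ε / 2), lt_min (by norm_num) (by linarith), min_le_left _ _, by
      linarith [min_le_right (1 / 2 : ℝ) (ε / 2)]⟩
  have hm : ∀ n : ℕ, ∃ m : ℕ, 0 < m ∧ 128 * (n : ℝ) ≤ δ * m := by
    intro n
    obtain ⟨m, hm⟩ := exists_nat_ge (128 * n / δ)
    refine ⟨m + 1, Nat.succ_pos _, ?_⟩
    rw [div_le_iff₀' hδ] at hm
    push_cast
    linarith
  choose m hm0 hm using hm
  have hN : ∀ n : ℕ, ∃ N : ℕ, n ≤ N ∧ 4 * K ^ (m n + 2) ≤ θ * N := by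
    intro n
    obtain ⟨N, hN⟩ := exists_nat_ge (4 * K ^ (m n + 2) / θ)
    refine ⟨n + N, Nat.le_add_right _ _, ?_⟩
    rw [div_le_iff₀' hθ0] at hN
    push_cast
    have : 0 ≤ θ * n := by positivity
    linarith
  choose N hnN hN using hN
  obtain ⟨I, hI⟩ := exists_nat_gt (8 / δ)
  have hI0' : (0 : ℝ) < I := lt_trans (by positivity) hI
  have hI0 : 0 < I := by exact_mod_cast hI0'
  rw [div_lt_iff₀' hδ] at hI
  set s : ℕ → ℕ := fun i => N^[i] 1 with hs
  have hs1 : ∀ i, 1 ≤ s i := by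
    intro i
    induction i with
    | zero => exact le_rfl
    | succ i ih =>
      simp only [hs, Function.iterate_succ_apply']
      exact ih.trans (hnN _)
  -- The successful scale depends on A; summing the exponents over all scales makes the constant
  -- uniform.
  refine ⟨1 / (4 * K ^ ∑ i ∈ Finset.range I, m (s i)), by positivity, ?_⟩
  intro G _ _ A hA hAA hAA'
  have h := adjointContractions_rightAverage A
  have hA0 : (0 : ℝ) < A.card := by exact_mod_cast hA.card_pos
  obtain ⟨i, hi, hsmall⟩ := exists_lt_sub_le (C := A.card) hI0
    (e := fun i => normDefect (rightAverage A) (rightAverage A⁻¹) (s i) (indicatorL2 A)) (by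
      have h1 := h.normDefect_nonneg (s 0) (indicatorL2 A)
      have h2 : normDefect (rightAverage A) (rightAverage A⁻¹) (s I) (indicatorL2 A) ≤
          A.card := by
        rw [normDefect, norm_sq_indicatorL2]
        linarith [sq_nonneg ‖(complOp (rightAverage A) (rightAverage A⁻¹))^[s I] (indicatorL2 A)‖]
      linarith)
  have hsucc : s (i + 1) = N (s i) := Function.iterate_succ_apply' _ _ _
  simp only [hsucc] at hsmall
  obtain ⟨D, hD1, hD2, hD3, hD4⟩ := exists_isCentred_of_scales hK1 hδ hθ0 hθ hθε hδK hA hAA hAA'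
    (hs1 i) (hnN (s i)) (hm0 (s i)) (hm (s i)) (hN (s i)) (by
      refine le_of_mul_le_mul_left ?_ hI0'
      have := mul_le_mul_of_nonneg_right hI.le hA0.le
      linarith)
  refine ⟨D, hD1, hD2, ?_, hD4⟩
  rw [div_mul_eq_mul_div, one_mul, div_le_iff₀' (by positivity)]
  refine hD3.trans ?_
  have h1 : K ^ m (s i) ≤ K ^ ∑ i ∈ Finset.range I, m (s i) :=
    pow_le_pow_right₀ hK1 (Finset.single_le_sum (f := fun i => m (s i))
      (fun _ _ => Nat.zero_le _) (Finset.mem_range.2 hi))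
  gcongr

end Core

/-! ### Passing to a subset with small doubling on the other side. -/

section Reduction

open Finset

variable {G : Type*} [Group G] [DecidableEq G]

/-- The pairs in `A × A` representing `x` as a quotient `a⁻¹ * b`. -/
def quotientPairs (A : Finset G) (x : G) : Finset (G × G) :=
  (A ×ˢ A).filter fun p => p.1⁻¹ * p.2 = x

theorem mem_quotientPairs {A : Finset G} {x : G} {p : G × G} :
    p ∈ quotientPairs A x ↔ (p.1 ∈ A ∧ p.2 ∈ A) ∧ p.1⁻¹ * p.2 = x := by
  simp [quotientPairs]

theorem card_quotientPairs_le (A : Finset G) (x : G) : (quotientPairs A x).card ≤ A.card := by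
  refine Finset.card_le_card_of_injOn Prod.fst
    (fun p hp => (mem_quotientPairs.1 (Finset.mem_coe.1 hp)).1.1) ?_
  rintro ⟨a, b⟩ hp ⟨a', b'⟩ hp' h
  have h1 := (mem_quotientPairs.1 (Finset.mem_coe.1 hp)).2
  have h2 := (mem_quotientPairs.1 (Finset.mem_coe.1 hp')).2
  simp only at h h1 h2
  subst h
  rw [← h2] at h1
  rw [mul_left_cancel h1]

theorem card_quotientPairs_inv (A : Finset G) (x : G) :
    (quotientPairs A x⁻¹).card = (quotientPairs A x).card := by
  refine Finset.card_bij' (fun p _ => p.swap) (fun p _ => p.swap) ?_ ?_ ?_ ?_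
  · intro p hp
    rw [mem_quotientPairs] at hp ⊢
    refine ⟨⟨hp.1.2, hp.1.1⟩, ?_⟩
    rw [← inv_inv x, ← hp.2]
    simp
  · intro p hp
    rw [mem_quotientPairs] at hp ⊢
    refine ⟨⟨hp.1.2, hp.1.1⟩, ?_⟩
    rw [← hp.2]
    simp
  · simp
  · simp

/-- Cauchy–Schwarz for the multiplicative energy of A and A⁻¹, with the equation ab⁻¹ = cd⁻¹
regrouped as c⁻¹a = d⁻¹b. -/
theorem card_pow_four_le (A : Finset G) :
    A.card ^ 4 ≤ (A * A⁻¹).card * ∑ p ∈ A ×ˢ A, (quotientPairs A (p.1⁻¹ * p.2)).card := by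
  have h1 := le_card_mul_mul_mulEnergy A A⁻¹
  have h2 : A.mulEnergy A⁻¹ = ∑ p ∈ A ×ˢ A, (quotientPairs A (p.1⁻¹ * p.2)).card := by
    simp only [quotientPairs, Finset.card_filter]
    rw [← Finset.sum_product (s := A ×ˢ A) (t := A ×ˢ A)
      (f := fun x => if x.2.1⁻¹ * x.2.2 = x.1.1⁻¹ * x.1.2 then 1 else 0),
      ← Finset.card_filter]
    refine Finset.card_bij' (fun x _ => ((x.2.2⁻¹, x.2.1⁻¹), (x.1.2, x.1.1)))
      (fun y _ => ((y.2.2, y.2.1), (y.1.2⁻¹, y.1.1⁻¹))) ?_ ?_ ?_ ?_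
    · rintro ⟨⟨a, b⟩, c, d⟩ h
      simp only [Finset.mem_filter, Finset.mem_product, Finset.mem_inv'] at h ⊢
      refine ⟨⟨⟨h.1.2.2, h.1.2.1⟩, h.1.1.2, h.1.1.1⟩, ?_⟩
      rw [inv_mul_eq_iff_eq_mul, inv_inv, ← mul_assoc, ← h.2]
      group
    · rintro ⟨⟨a, b⟩, c, d⟩ h
      simp only [Finset.mem_filter, Finset.mem_product, Finset.mem_inv', inv_inv] at h ⊢
      refine ⟨⟨⟨h.1.2.2, h.1.2.1⟩, h.1.1.2, h.1.1.1⟩, ?_⟩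
      rw [inv_mul_eq_iff_eq_mul] at h
      rw [h.2]
      group
    · simp
    · simp
  rw [Finset.card_inv, h2] at h1
  calc A.card ^ 4 = A.card ^ 2 * A.card ^ 2 := by ring
    _ ≤ _ := h1

/-- If two elements have many representations as quotients, so does their quotient as a
twisted product. -/
theorem card_quotientPairs_mul_le (A : Finset G) (x y : G) :
    (quotientPairs A x).card * (quotientPairs A y).card ≤
      ((A ×ˢ (A * A⁻¹) ×ˢ A).filter fun t => t.1⁻¹ * t.2.1 * t.2.2 = x * y).card := by
  rw [← Finset.card_product]
  refine Finset.card_le_card_of_injOn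
    (fun q => (q.1.1, q.1.2 * q.2.1⁻¹, q.2.2)) ?_ ?_
  · rintro ⟨p, q⟩ h
    obtain ⟨hp, hq⟩ := Finset.mem_product.1 (Finset.mem_coe.1 h)
    rw [mem_quotientPairs] at hp hq
    refine Finset.mem_coe.2 (Finset.mem_filter.2 ⟨Finset.mem_product.2 ⟨hp.1.1,
      Finset.mem_product.2 ⟨Finset.mul_mem_mul hp.1.2 (Finset.inv_mem_inv hq.1.1), hq.1.2⟩⟩, ?_⟩)
    simp only
    rw [← hp.2, ← hq.2]
    group
  · rintro ⟨⟨a, b⟩, c, d⟩ h ⟨⟨a', b'⟩, c', d'⟩ h' heq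
    obtain ⟨hp, hq⟩ := Finset.mem_product.1 (Finset.mem_coe.1 h)
    obtain ⟨hp', hq'⟩ := Finset.mem_product.1 (Finset.mem_coe.1 h')
    rw [mem_quotientPairs] at hp hq hp' hq'
    simp only [Prod.mk.injEq] at heq
    obtain ⟨rfl, h2, rfl⟩ := heq
    obtain rfl : b = b' := mul_left_cancel (hp.2.trans hp'.2.symm)
    obtain rfl : c = c' := inv_injective (mul_left_cancel h2)
    rfl

/-- Writing b⁻¹b' = (a⁻¹b)⁻¹(a⁻¹b') gives each element of B⁻¹B at least t² representations by
triples from A × A A⁻¹ × A; count all triples. -/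
theorem card_inv_mul_mul_le {A B : Finset G} {t : ℝ} (ht : 0 ≤ t) {a : G}
    (hB : ∀ b ∈ B, t ≤ (quotientPairs A (a⁻¹ * b)).card) :
    ((B⁻¹ * B).card : ℝ) * t ^ 2 ≤ A.card * ((A * A⁻¹).card * A.card) := by
  have h1 : ∀ z ∈ B⁻¹ * B, t ^ 2 ≤
      (((A ×ˢ (A * A⁻¹) ×ˢ A).filter fun p => p.1⁻¹ * p.2.1 * p.2.2 = z).card : ℝ) := by
    intro z hz
    obtain ⟨b, hb, b', hb', rfl⟩ := Finset.mem_mul.1 hz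
    rw [Finset.mem_inv'] at hb
    have h2 := hB _ hb
    rw [← card_quotientPairs_inv] at h2
    have h3 := card_quotientPairs_mul_le A (a⁻¹ * b⁻¹)⁻¹ (a⁻¹ * b')
    have h4 : (a⁻¹ * b⁻¹)⁻¹ * (a⁻¹ * b') = b * b' := by group
    rw [h4] at h3
    calc t ^ 2 = t * t := sq t
      _ ≤ (quotientPairs A (a⁻¹ * b⁻¹)⁻¹).card * (quotientPairs A (a⁻¹ * b')).card :=
        mul_le_mul h2 (hB _ hb') ht (Nat.cast_nonneg _)
      _ ≤ _ := by exact_mod_cast h3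
  have h2 := Finset.sum_le_sum h1
  rw [Finset.sum_const, nsmul_eq_mul] at h2
  refine h2.trans ?_
  have h3 : ∑ z ∈ B⁻¹ * B,
      ((A ×ˢ (A * A⁻¹) ×ˢ A).filter fun p => p.1⁻¹ * p.2.1 * p.2.2 = z).card ≤
      (A ×ˢ (A * A⁻¹) ×ˢ A).card := by
    rw [Finset.sum_card_fiberwise_eq_card_filter]
    exact Finset.card_filter_le _ _
  rw [Finset.card_product, Finset.card_product] at h3
  exact_mod_cast h3

/-- A set with small doubling contains a large subset with small doubling on the other side. -/
theorem exists_subset_card_inv_mul_le {K : ℝ} (hK0 : 0 < K) {A : Finset G} (hA : A.Nonempty)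
    (hK : ((A * A⁻¹).card : ℝ) ≤ K * A.card) :
    ∃ B ⊆ A, (A.card : ℝ) ≤ 2 * K * B.card ∧
      ((B⁻¹ * B).card : ℝ) ≤ 4 * K ^ 3 * A.card := by
  classical
  have hA0 : (0 : ℝ) < A.card := by exact_mod_cast hA.card_pos
  -- The average of the counts `quotientPairs` over A × A is at least |A|/K. Half of it is the
  -- popularity threshold: popular and unpopular pairs would each contribute at most t|A| per row if
  -- every row had fewer than t popular entries.
  obtain ⟨t, ht0, htK⟩ : ∃ t : ℝ, 0 < t ∧ 2 * K * t = A.card :=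
    ⟨A.card / (2 * K), by positivity, by field_simp⟩
  set B : G → Finset G := fun a => A.filter fun b => t ≤ (quotientPairs A (a⁻¹ * b)).card
    with hB
  have h1 : ∃ a ∈ A, t ≤ (B a).card := by
    by_contra! hcon
    have h2 : ∀ a ∈ A, ∑ b ∈ A, ((quotientPairs A (a⁻¹ * b)).card : ℝ) <
        t * A.card + t * A.card := by
      intro a ha
      rw [← Finset.sum_filter_add_sum_filter_not A
        (fun b => t ≤ (quotientPairs A (a⁻¹ * b)).card)]
      have h3 : ∑ b ∈ B a, ((quotientPairs A (a⁻¹ * b)).card : ℝ) ≤ (B a).card * A.card := by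
        rw [← nsmul_eq_mul, ← Finset.sum_const]
        exact Finset.sum_le_sum fun b _ => by exact_mod_cast card_quotientPairs_le A _
      have h4 : ∑ b ∈ A.filter (fun b => ¬ t ≤ (quotientPairs A (a⁻¹ * b)).card),
          ((quotientPairs A (a⁻¹ * b)).card : ℝ) ≤ A.card * t := by
        refine (Finset.sum_le_sum (g := fun _ => t) fun b hb =>
          (not_le.1 (Finset.mem_filter.1 hb).2).le).trans ?_
        rw [Finset.sum_const, nsmul_eq_mul]
        refine mul_le_mul_of_nonneg_right ?_ ht0.le
        exact_mod_cast Finset.card_filter_le _ _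
      have h5 := mul_lt_mul_of_pos_right (hcon a ha) hA0
      linarith
    have h3 := Finset.sum_lt_sum_of_nonempty hA h2
    rw [Finset.sum_const, nsmul_eq_mul] at h3
    have h4 : (A.card : ℝ) ^ 4 ≤
        (A * A⁻¹).card * ∑ a ∈ A, ∑ b ∈ A, ((quotientPairs A (a⁻¹ * b)).card : ℝ) := by
      have := card_pow_four_le A
      rw [Finset.sum_product] at this
      exact_mod_cast this
    have h5 := mul_le_mul_of_nonneg_right hK (Finset.sum_nonneg fun a _ =>
      Finset.sum_nonneg fun b _ => Nat.cast_nonneg (α := ℝ) (quotientPairs A (a⁻¹ * b)).card :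
      0 ≤ ∑ a ∈ A, ∑ b ∈ A, ((quotientPairs A (a⁻¹ * b)).card : ℝ))
    have h6 := mul_lt_mul_of_pos_left h3 (mul_pos hK0 hA0)
    have h7 : K * A.card * (A.card * (t * A.card + t * A.card)) = (A.card : ℝ) ^ 4 := by
      rw [← htK]; ring
    linarith
  obtain ⟨a, -, ha⟩ := h1
  refine ⟨B a, Finset.filter_subset _ _, ?_, ?_⟩
  · rw [← htK]
    exact mul_le_mul_of_nonneg_left ha (by positivity)
  · have h2 := card_inv_mul_mul_le ht0.le (A := A) (B := B a) (a := a)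
      fun b hb => (Finset.mem_filter.1 hb).2
    have h3 : (A.card : ℝ) * ((A * A⁻¹).card * A.card) ≤ 4 * K ^ 3 * A.card * t ^ 2 := by
      have h4 := mul_le_mul_of_nonneg_right hK (sq_nonneg (A.card : ℝ))
      have h5 : K * A.card * (A.card : ℝ) ^ 2 = 4 * K ^ 3 * A.card * t ^ 2 := by
        rw [← htK]; ring
      linarith
    exact le_of_mul_le_mul_right (h2.trans h3) (pow_pos ht0 2)

end Reduction

theorem mainTheorem10 (K : ℝ) (hK : 0 < K) (k₀ : ℕ) (hk₀ : 1 ≤ k₀) (ε : ℝ) (hε : 0 < ε) :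
    ∃ c : ℝ, 0 < c ∧
      ∀ (G : Type*) [Group G] [DecidableEq G] (A : Finset G), A.Nonempty →
        ((A * A⁻¹).card : ℝ) ≤ K * (A.card : ℝ) →
        ∃ D : Finset G, IsCentred D ∧ D ⊆ A * A⁻¹ ∧ c * (A.card : ℝ) ≤ (D.card : ℝ) ∧
          ∀ k : ℕ, 1 ≤ k → k ≤ k₀ →
            (1 - ε) * (D.card : ℝ) ^ k ≤ ((tuplesWithProdIn k D (A * A⁻¹)).card : ℝ) := by
  -- As |A| ≤ 2K|B|, the two doubling constants of B are at most 2K² and 4K³·2K = 8K⁴; the added 1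
  -- makes the common bound at least 1.
  obtain ⟨c, hc, h⟩ := exists_isCentred_of_two_sided
    (le_add_of_nonneg_right (by positivity) : 1 ≤ 1 + (2 * K ^ 2 + 8 * K ^ 4)) k₀ hε
  refine ⟨c / (2 * K), by positivity, ?_⟩
  intro G _ _ A hA hAA
  have hA0 : (0 : ℝ) < A.card := by exact_mod_cast hA.card_pos
  obtain ⟨B, hBA, hB1, hB2⟩ := exists_subset_card_inv_mul_le hK hA hAA
  have hBB : B * B⁻¹ ⊆ A * A⁻¹ := Finset.mul_subset_mul hBA (Finset.inv_subset_inv hBA)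
  have hB0 : (0 : ℝ) < B.card := by
    by_contra hcon
    have : (B.card : ℝ) = 0 := le_antisymm (not_lt.1 hcon) (Nat.cast_nonneg _)
    rw [this] at hB1
    linarith
  have hBne : B.Nonempty := Finset.card_pos.1 (by exact_mod_cast hB0)
  obtain ⟨D, hD1, hD2, hD3, hD4⟩ := h G B hBne (by
      have h1 : ((B * B⁻¹).card : ℝ) ≤ (A * A⁻¹).card := by
        exact_mod_cast Finset.card_le_card hBB
      have h2 := mul_le_mul_of_nonneg_left hB1 hK.le
      have h3 : 0 ≤ (1 + 8 * K ^ 4) * (B.card : ℝ) := by positivity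
      linarith) (by
      have h2 := mul_le_mul_of_nonneg_left hB1 (by positivity : 0 ≤ 4 * K ^ 3)
      have h3 : 0 ≤ (1 + 2 * K ^ 2) * (B.card : ℝ) := by positivity
      linarith)
  refine ⟨D, hD1, hD2.trans hBB, ?_, fun k hk1 hk => (hD4 k hk1 hk).trans ?_⟩
  · refine le_trans ?_ hD3
    rw [div_mul_eq_mul_div, div_le_iff₀ (by positivity)]
    have := mul_le_mul_of_nonneg_left hB1 hc.le
    linarith
  · exact_mod_cast Finset.card_le_card
      (Finset.monotone_filter_right _ fun d _ hd => hBB hd)
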